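/- Let $N\ge 0$, $d\ge 0$ be integers, let $k_1\in\{0,\dots,N\}$, and let $[x_k]=(x_0,\dots,x_N)$ be a zero-mean nonsingular Gaussian sequence of random vectors in $\mathbb R^d$ on a probability space, i.e. $x_0,\dots,x_N$ are jointly Gaussian with mean zero and the covariance matrix of the stacked vector $[x_0',\dots,x_N']'$ is nonsingular (here $'$ denotes transposition). The sequence is called $CM_L$ if, conditioned on $x_N$, it is Markov over $\{0,\dots,N-1\}$; that is, for every $j\in\{0,\dots,N-1\}$, $(x_i)_{0\le i<j}$ and $(x_i)_{j<i\le N-1}$ are conditionally independent given $(x_j,x_N)$. It is called $[k_1,N]$-$CM_F$ if, conditioned on $x_{k_1}$, it is Markov over $\{k_1+1,\dots,N\}$; that is, for every $j\in\{k_1+1,\dots,N\}$, $(x_i)_{k_1+1\le i<j}$ and $(x_i)_{j<i\le N}$ are conditionally independent given $(x_j,x_{k_1})$. Then $[x_k]$ is both $CM_L$ and $[k_1,N]$-$CM_F$ if and only if there are $d\times d$ real matrices $G_{k,k-1}$, $G_{k,N}$ ($1\le k\le N-1$) and $G_{0,N}$, and a zero-mean nonsingular Gaussian sequence $[e_k]=(e_0,\dots,e_N)$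 of random vectors in $\mathbb R^d$ on the same probability space that is white ($\operatorname{Cov}(e_i,e_j)=0$ for $i\ne j$), such that, almost surely, $$x_k=G_{k,k-1}x_{k-1}+G_{k,N}x_N+e_k,\qquad 1\le k\le N-1,$$ with boundary condition $$x_N=e_N,\qquad x_0=G_{0,N}x_N+e_0,$$ and such that, with $G_k:=\operatorname{Cov}(e_k)$, $$G_k^{-1}G_{k,N}=G_{k+1,k}'\,G_{k+1}^{-1}\,G_{k+1,N}\qquad\text{for all } k\in\{k_1+1,\dots,N-2\}$$ (no condition if $k_1\ge N-2$). -/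

import Mathlib

open MeasureTheory ProbabilityTheory
open scoped Matrix

namespace CMSeq

noncomputable section

/-- The matrix `Cov(X, Y)` (of size `d × d`) of two `ℝ^d`-valued random vectors. -/
def covMatrix {Ω : Type*} [MeasurableSpace Ω] (P : Measure Ω) {d : ℕ}
    (X Y : Ω → Fin d → ℝ) : Matrix (Fin d) (Fin d) ℝ :=
  Matrix.of fun i j => cov[fun ω => X ω i, fun ω => Y ω j; P]

/-- The covariance matrix `C` of the whole sequence `x_0, …, x_N`, that is, of the stacked vector
`[x_0', x_1', …, x_N']'`; its rows and columns are indexed by pairs (time, coordinate). -/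
def seqCov {Ω : Type*} [MeasurableSpace Ω] (P : Measure Ω) {d : ℕ} (N : ℕ)
    (x : ℕ → Ω → Fin d → ℝ) : Matrix (Fin (N + 1) × Fin d) (Fin (N + 1) × Fin d) ℝ :=
  Matrix.of fun p q => covMatrix P (x p.1) (x q.1) p.2 q.2

/-- `x_0, …, x_N` is a zero-mean nonsingular Gaussian sequence of random vectors in `ℝ^d`:
it is jointly Gaussian, its mean vanishes, and the covariance matrix of the whole sequence is
nonsingular. Values `x k` with `k > N` play no role. -/
structure IsZMNG {Ω : Type*} [MeasurableSpace Ω] (P : Measure Ω) {d : ℕ} (N : ℕ)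
    (x : ℕ → Ω → Fin d → ℝ) : Prop where
  measurable : ∀ k ≤ N, Measurable (x k)
  gaussian : HasGaussianLaw (fun ω (k : Fin (N + 1)) => x k ω) P
  zero_mean : ∀ k ≤ N, ∀ i : Fin d, ∫ ω, x k ω i ∂P = 0
  nonsingular : (seqCov P N x).det ≠ 0

/-- The sequence `e_0, …, e_N` is white: values at different times are uncorrelated. -/
def IsWhite {Ω : Type*} [MeasurableSpace Ω] (P : Measure Ω) {d : ℕ} (N : ℕ)
    (e : ℕ → Ω → Fin d → ℝ) : Prop :=
  ∀ i ≤ N, ∀ j ≤ N, i ≠ j → covMatrix P (e i) (e j) = 0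

/-- The σ-algebra generated by the `x i` with `i ∈ s`. -/
@[reducible] def sigmaOf {Ω : Type*} {d : ℕ} (x : ℕ → Ω → Fin d → ℝ) (s : Set ℕ) : MeasurableSpace Ω :=
  ⨆ i ∈ s, MeasurableSpace.comap (x i) inferInstance

/-- The σ-algebras `m₁` and `m₂` are conditionally independent given `m`:
`P(A ∩ B | m) = P(A | m) P(B | m)` almost surely for `A ∈ m₁`, `B ∈ m₂`.
(Mathlib's `ProbabilityTheory.CondIndep`, without its assumption that `Ω` is standard Borel.) -/
def CondIndepGiven {Ω : Type*} (m m₁ m₂ : MeasurableSpace Ω) {mΩ : MeasurableSpace Ω}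
    (P : Measure Ω) : Prop :=
  ∀ A B : Set Ω, MeasurableSet[m₁] A → MeasurableSet[m₂] B →
    P⟦A ∩ B | m⟧ =ᵐ[P] P⟦A | m⟧ * P⟦B | m⟧

/-- Conditioned on `m`, the sequence `x` is Markov over the time set `s`: for every time `j` in `s`,
the past and the future of `j` within `s` are conditionally independent given `x j` and `m`. -/
def IsMarkovGiven {Ω : Type*} (m : MeasurableSpace Ω) {mΩ : MeasurableSpace Ω}
    (P : Measure Ω) {d : ℕ} (x : ℕ → Ω → Fin d → ℝ) (s : Set ℕ) : Prop :=
  ∀ j ∈ s, CondIndepGiven (m ⊔ sigmaOf x {j})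
    (sigmaOf x (s ∩ Set.Iio j)) (sigmaOf x (s ∩ Set.Ioi j)) P

/-- `[k₁,k₂]-CM_F`: conditioned on the state at the first time `k₁`, the sequence is Markov over
`[k₁ + 1, k₂]`. -/
def IsCMF {Ω : Type*} [MeasurableSpace Ω] (P : Measure Ω) {d : ℕ}
    (k₁ k₂ : ℕ) (x : ℕ → Ω → Fin d → ℝ) : Prop :=
  IsMarkovGiven (sigmaOf x {k₁}) P x (Set.Icc (k₁ + 1) k₂)

/-- `[k₁,k₂]-CM_L`: conditioned on the state at the last time `k₂`, the sequence is Markov over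
`[k₁, k₂ - 1]`. -/
def IsCML {Ω : Type*} [MeasurableSpace Ω] (P : Measure Ω) {d : ℕ}
    (k₁ k₂ : ℕ) (x : ℕ → Ω → Fin d → ℝ) : Prop :=
  IsMarkovGiven (sigmaOf x {k₂}) P x (Set.Ico k₁ k₂)

/-- `x_0, …, x_N` obeys the `CM_L` model with the matrices `G_{k,k-1}`, `G_{k,N}` (`1 ≤ k ≤ N - 1`)
and `G_{0,N}`, and driving noise `e`:
`x_k = G_{k,k-1} x_{k-1} + G_{k,N} x_N + e_k` for `1 ≤ k ≤ N - 1`, with boundary condition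
`x_N = e_N`, `x_0 = G_{0,N} x_N + e_0`, where `e_0, …, e_N` is a zero-mean white nonsingular
Gaussian sequence. The other entries of `G` play no role. -/
structure ObeysCMLModel {Ω : Type*} [MeasurableSpace Ω] (P : Measure Ω) {d : ℕ} (N : ℕ)
    (G : ℕ → ℕ → Matrix (Fin d) (Fin d) ℝ) (e x : ℕ → Ω → Fin d → ℝ) : Prop where
  noise : IsZMNG P N e
  white : IsWhite P N e
  step : ∀ k, 1 ≤ k → k < N →
    ∀ᵐ ω ∂P, x k ω = G k (k - 1) *ᵥ x (k - 1) ω + G k N *ᵥ x N ω + e k ω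
  final : ∀ᵐ ω ∂P, x N ω = e N ω
  initial : ∀ᵐ ω ∂P, x 0 ω = G 0 N *ᵥ x N ω + e 0 ω

end

end CMSeq

/-! For jointly Gaussian vectors conditional independence is a statement about orthogonal
projections: the blocks indexed by `B` are conditionally independent of those indexed by `A` given
those indexed by `S` exactly when the residual of each `B`-component after projection onto the span
of the `S`-blocks is orthogonal to the `A`-blocks (`condIndepGiven_iff`). The whole question thus
moves to blocks of vectors in the Hilbert space `L²`.

There, projecting `x k` on `x (k - 1)` and `x N` produces the model from the `CM_L` property, and
the residuals are white because each is orthogonal to the earlier states and to `x N`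
(`exists_linearModel`). Conversely, iterating the recursion from time `j` leaves only noise
orthogonal to the past and to `x N` (`LinearModel.condOrth`).

The matrix condition comes from the dual basis, that is, from the rows of the inverse covariance.
For `k + 2 ≤ N` the block `dual G e k`, built from `e k` and `e (k + 1)`, pairs to the identity with
`x k` and to zero with every other state. Written in the states, it involves only `x (k - 1)`, `x
k`, `x (k + 1)` and `x N`, and its coefficient at `x N` is the difference of the two sides of the
condition. So the condition says that the inverse covariance has no `(k, N)` block, and
`LinearModel.condOrth_iff` shows that this vanishing for all `k > k₁` is the `CM_F` property. This
works for any model of `x`, so the model supplied by `CM_L` serves both directions. -/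

namespace CMSeq

/-! ### Spans and projections of blocks of vectors in a Hilbert space -/

section LinearTheory

variable {H : Type*} [NormedAddCommGroup H] [InnerProductSpace ℝ H] {d : ℕ}

/-- The span of the components of the blocks `x k` with `k ∈ S`. -/
def blockSpan (x : ℕ → Fin d → H) (S : Set ℕ) : Submodule ℝ H :=
  Submodule.span ℝ {v | ∃ k ∈ S, ∃ i, x k i = v}

/-- Linear conditional orthogonality: modulo the span of the blocks indexed by `S`, the blocks
indexed by `B` are orthogonal to the blocks indexed by `A`. -/
def CondOrth (x : ℕ → Fin d → H) (S A B : Set ℕ) : Prop :=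
  ∀ b ∈ B, ∀ i, ∃ u ∈ blockSpan x S, ∀ k ∈ A ∪ S, ∀ j, inner ℝ (x b i - u) (x k j) = 0

/-- The action of a matrix on a block of vectors. -/
def blockMul (M : Matrix (Fin d) (Fin d) ℝ) (v : Fin d → H) : Fin d → H :=
  fun a => ∑ b, M a b • v b

/-- The matrix of inner products of two blocks of vectors. -/
def crossGram (u v : Fin d → H) : Matrix (Fin d) (Fin d) ℝ :=
  Matrix.of fun a b => inner ℝ (u a) (v b)

lemma mem_blockSpan {x : ℕ → Fin d → H} {S : Set ℕ} {k : ℕ} (hk : k ∈ S) (i : Fin d) :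
    x k i ∈ blockSpan x S :=
  Submodule.subset_span ⟨k, hk, i, rfl⟩

lemma blockMul_mem {x : ℕ → Fin d → H} {S : Set ℕ} {k : ℕ} (hk : k ∈ S)
    (M : Matrix (Fin d) (Fin d) ℝ) (i : Fin d) : blockMul M (x k) i ∈ blockSpan x S :=
  Submodule.sum_mem _ fun b _ => Submodule.smul_mem _ _ (mem_blockSpan hk b)

lemma inner_eq_zero_of_mem_blockSpan {x : ℕ → Fin d → H} {S : Set ℕ} {v u : H}
    (hv : ∀ k ∈ S, ∀ j, inner ℝ v (x k j) = 0) (hu : u ∈ blockSpan x S) : inner ℝ v u = 0 := by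
  induction hu using Submodule.span_induction with
  | mem w hw => obtain ⟨k, hk, i, rfl⟩ := hw; exact hv k hk i
  | zero => simp
  | add _ _ _ _ h₁ h₂ => simp [inner_add_right, h₁, h₂]
  | smul c _ _ h => simp [inner_smul_right, h]

lemma exists_sum_of_mem_blockSpan {x : ℕ → Fin d → H} {S : Finset ℕ} {u : H}
    (hu : u ∈ blockSpan x S) : ∃ c : ℕ → Fin d → ℝ, u = ∑ k ∈ S, ∑ i, c k i • x k i := by
  classical
  induction hu using Submodule.span_induction with
  | mem w hw =>
    obtain ⟨k, hk, i, rfl⟩ := hw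
    refine ⟨fun l j => if l = k ∧ j = i then 1 else 0, ?_⟩
    rw [Finset.sum_eq_single k, Finset.sum_eq_single i]
    · simp
    · intro j _ hj; simp [hj]
    · simp
    · intro l _ hl; simp [hl]
    · intro h; exact absurd hk h
  | zero => exact ⟨0, by simp⟩
  | add _ _ _ _ h₁ h₂ =>
    obtain ⟨c₁, rfl⟩ := h₁
    obtain ⟨c₂, rfl⟩ := h₂
    exact ⟨c₁ + c₂, by simp [add_smul, Finset.sum_add_distrib]⟩
  | smul a _ _ h =>
    obtain ⟨c, rfl⟩ := h
    exact ⟨a • c, by simp [mul_smul, Finset.smul_sum]⟩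

/-- The case `a = b` is allowed, so that the lemma also serves for a single block. -/
lemma exists_pair_of_mem_blockSpan {x : ℕ → Fin d → H} {a b : ℕ} {v : Fin d → H}
    (hv : ∀ i, v i ∈ blockSpan x {a, b}) :
    ∃ A B : Matrix (Fin d) (Fin d) ℝ, v = blockMul A (x a) + blockMul B (x b) := by
  have (i : Fin d) : ∃ A B : Fin d → ℝ, v i = ∑ j, A j • x a j + ∑ j, B j • x b j := by
    have h := hv i
    rw [show ({a, b} : Set ℕ) = ↑({a, b} : Finset ℕ) by simp] at h
    obtain ⟨c, hc⟩ := exists_sum_of_mem_blockSpan h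
    by_cases hab : a = b
    · subst hab
      exact ⟨c a, 0, by simpa using hc⟩
    · exact ⟨c a, c b, by rw [hc, Finset.sum_pair hab]⟩
  choose A B h using this
  exact ⟨A, B, funext h⟩

lemma exists_blockSpan_sub_orth (x : ℕ → Fin d → H) (S : Finset ℕ) (v : H) :
    ∃ u ∈ blockSpan x S, ∀ k ∈ S, ∀ j, inner ℝ (v - u) (x k j) = 0 := by
  have : FiniteDimensional ℝ (blockSpan x S) := by
    refine FiniteDimensional.span_of_finite ℝ ?_
    refine ((S.finite_toSet.prod (Set.finite_univ (α := Fin d))).image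
      fun p => x p.1 p.2).subset ?_
    rintro _ ⟨k, hk, i, rfl⟩
    exact ⟨(k, i), ⟨hk, trivial⟩, rfl⟩
  refine ⟨(blockSpan x S).starProjection v, Submodule.starProjection_apply_mem _ _,
    fun k hk j => ?_⟩
  exact Submodule.starProjection_inner_eq_zero _ _ (mem_blockSpan (by exact_mod_cast hk) j)

/-! ### Matrix calculus for blocks and their Gram matrices -/

section crossGram

variable (M : Matrix (Fin d) (Fin d) ℝ) (u v w : Fin d → H)

lemma crossGram_add_left : crossGram (u + v) w = crossGram u w + crossGram v w := by
  ext; simp [crossGram, inner_add_left]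

lemma crossGram_add_right : crossGram u (v + w) = crossGram u v + crossGram u w := by
  ext; simp [crossGram, inner_add_right]

lemma crossGram_sub_left : crossGram (u - v) w = crossGram u w - crossGram v w := by
  ext; simp [crossGram, inner_sub_left]

lemma crossGram_sub_right : crossGram u (v - w) = crossGram u v - crossGram u w := by
  ext; simp [crossGram, inner_sub_right]

lemma crossGram_blockMul_left : crossGram (blockMul M u) v = M * crossGram u v := by
  ext; simp [crossGram, blockMul, sum_inner, inner_smul_left, Matrix.mul_apply]

lemma crossGram_blockMul_right : crossGram u (blockMul M v) = crossGram u v * Mᵀ := by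
  ext; simp [crossGram, blockMul, inner_sum, inner_smul_right, Matrix.mul_apply, mul_comm]

lemma crossGram_transpose : (crossGram u v)ᵀ = crossGram v u := by
  ext; simp [crossGram, real_inner_comm]

variable {u v} in
lemma crossGram_eq_zero_comm : crossGram u v = 0 ↔ crossGram v u = 0 := by
  rw [← crossGram_transpose, Matrix.transpose_eq_zero]

variable {u} in
lemma eq_zero_of_crossGram_self (h : crossGram u u = 0) : u = 0 := by
  ext a
  simpa [crossGram] using congrFun (congrFun h a) a

variable {u v} in
lemma crossGram_eq_zero_iff : crossGram u v = 0 ↔ ∀ i j, inner ℝ (u i) (v j) = 0 := by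
  simp [← Matrix.ext_iff, crossGram]

end crossGram

section blockMul

variable (M M' : Matrix (Fin d) (Fin d) ℝ) (u v : Fin d → H)

lemma blockMul_add : blockMul M (u + v) = blockMul M u + blockMul M v := by
  ext; simp [blockMul, Finset.sum_add_distrib]

lemma blockMul_sub : blockMul M (u - v) = blockMul M u - blockMul M v := by
  ext; simp [blockMul, smul_sub]

lemma add_blockMul : blockMul (M + M') u = blockMul M u + blockMul M' u := by
  ext; simp [blockMul, add_smul, Finset.sum_add_distrib]

lemma sub_blockMul : blockMul (M - M') u = blockMul M u - blockMul M' u := by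
  ext; simp [blockMul, sub_smul]

lemma mul_blockMul : blockMul (M * M') u = blockMul M (blockMul M' u) := by
  ext a
  simp only [blockMul, Matrix.mul_apply, Finset.sum_smul, Finset.smul_sum, mul_smul]
  exact Finset.sum_comm

lemma one_blockMul : blockMul 1 u = u := by
  ext; simp [blockMul, Matrix.one_apply]

lemma zero_blockMul : blockMul 0 u = 0 := by
  ext; simp [blockMul]

end blockMul

/-- The blocks `x 0, …, x N` are linearly independent. -/
def BlockIndep (N : ℕ) (x : ℕ → Fin d → H) : Prop :=
  LinearIndependent ℝ fun p : Fin (N + 1) × Fin d => x p.1 p.2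

lemma BlockIndep.linearIndependent {N : ℕ} {x : ℕ → Fin d → H} (hx : BlockIndep N x) {k : ℕ}
    (hk : k ≤ N) : LinearIndependent ℝ (x k) :=
  LinearIndependent.comp hx (fun i => ((⟨k, by omega⟩ : Fin (N + 1)), i))
    fun _ _ h => (Prod.ext_iff.1 h).2

lemma BlockIndep.isUnit_crossGram {N : ℕ} {x : ℕ → Fin d → H} (hx : BlockIndep N x) {k : ℕ}
    (hk : k ≤ N) : IsUnit (crossGram (x k) (x k)).det :=
  isUnit_iff_ne_zero.2 (Matrix.det_gram_ne_zero_iff_linearIndependent.2 (hx.linearIndependent hk))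

lemma blockSpan_le_span_image (x : ℕ → Fin d → H) {N : ℕ} {S : Set ℕ} (hS : S ⊆ Set.Iic N) :
    blockSpan x S ≤ Submodule.span ℝ ((fun p : Fin (N + 1) × Fin d => x p.1 p.2) ''
      {p | (p.1 : ℕ) ∈ S}) := by
  refine Submodule.span_mono ?_
  intro v hv
  obtain ⟨l, hl, i, hv⟩ := hv
  exact (Set.mem_image _ _ _).2 ⟨(⟨l, Nat.lt_succ_of_le (hS hl)⟩, i), hl, hv⟩

lemma BlockIndep.disjoint_blockSpan {N : ℕ} {x : ℕ → Fin d → H} (hx : BlockIndep N x)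
    {S T : Set ℕ} (hS : S ⊆ Set.Iic N) (hT : T ⊆ Set.Iic N) (hST : Disjoint S T) :
    Disjoint (blockSpan x S) (blockSpan x T) := by
  have h : Disjoint {p : Fin (N + 1) × Fin d | (p.1 : ℕ) ∈ S} {p | (p.1 : ℕ) ∈ T} :=
    Set.disjoint_left.2 fun _ h₁ h₂ => Set.disjoint_left.1 hST h₁ h₂
  exact (LinearIndependent.disjoint_span_image hx h).mono (blockSpan_le_span_image x hS)
    (blockSpan_le_span_image x hT)

lemma BlockIndep.eq_zero_of_blockMul_mem {N : ℕ} {x : ℕ → Fin d → H} (hx : BlockIndep N x)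
    {k : ℕ} (hk : k ≤ N) {S : Set ℕ} (hS : S ⊆ Set.Iic N) (hkS : k ∉ S)
    {M : Matrix (Fin d) (Fin d) ℝ} (hM : ∀ i, blockMul M (x k) i ∈ blockSpan x S) : M = 0 := by
  have hdisj := hx.disjoint_blockSpan (Set.singleton_subset_iff.2 (Set.mem_Iic.2 hk)) hS
    (Set.disjoint_singleton_left.2 hkS)
  ext i j
  have h0 := Submodule.disjoint_def.1 hdisj _ (blockMul_mem (Set.mem_singleton k) M i) (hM i)
  exact Fintype.linearIndependent_iff.1 (hx.linearIndependent hk) _ h0 j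

/-- A dimension count: the two families have the same number of vectors, and the span of `e`
contains an independent family of that size. -/
lemma BlockIndep.of_mem_blockSpan {N : ℕ} {x e : ℕ → Fin d → H} (hx : BlockIndep N x)
    (h : ∀ k ≤ N, ∀ i, x k i ∈ blockSpan e (Set.Iic N)) : BlockIndep N e := by
  refine linearIndependent_iff_card_le_finrank_span.2 ?_
  rw [linearIndependent_iff_card_eq_finrank_span.1 hx]
  have : FiniteDimensional ℝ (Submodule.span ℝ
      (Set.range fun p : Fin (N + 1) × Fin d => e p.1 p.2)) :=
    FiniteDimensional.span_of_finite ℝ (Set.finite_range _)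
  refine Submodule.finrank_mono (Submodule.span_le.2 ?_)
  rintro _ ⟨p, rfl⟩
  exact Submodule.span_mono (Set.image_subset_range _ _)
    (blockSpan_le_span_image e le_rfl (h p.1 (Nat.lt_succ_iff.1 p.1.2) p.2))

/-- A linear model of `CM_L` type with driving white noise `e`. -/
structure LinearModel (N : ℕ) (G : ℕ → ℕ → Matrix (Fin d) (Fin d) ℝ) (e x : ℕ → Fin d → H) :
    Prop where
  indep : BlockIndep N e
  white : ∀ i ≤ N, ∀ j ≤ N, i ≠ j → crossGram (e i) (e j) = 0
  step : ∀ k, 1 ≤ k → k < N →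
    x k = blockMul (G k (k - 1)) (x (k - 1)) + blockMul (G k N) (x N) + e k
  final : x N = e N
  initial : x 0 = blockMul (G 0 N) (x N) + e 0

/-! ### Consequences of the model: the Markov property, the dual basis and the matrix condition -/

namespace LinearModel

variable {N : ℕ} {G : ℕ → ℕ → Matrix (Fin d) (Fin d) ℝ} {e x : ℕ → Fin d → H}

lemma crossGram_noise_final (h : LinearModel N G e x) {k : ℕ} (hk : k < N) :
    crossGram (e k) (x N) = 0 := by
  rw [h.final]
  exact h.white k hk.le N le_rfl hk.ne

lemma crossGram_noise_state (h : LinearModel N G e x) {k : ℕ} (hk : k < N) {l : ℕ} (hl : l < k) :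
    crossGram (e k) (x l) = 0 := by
  induction l with
  | zero =>
    rw [h.initial, crossGram_add_right, crossGram_blockMul_right, h.crossGram_noise_final hk,
      h.white k hk.le 0 (by omega) (by omega)]
    simp
  | succ l ih =>
    rw [h.step (l + 1) (by omega) (by omega), crossGram_add_right, crossGram_add_right,
      crossGram_blockMul_right, crossGram_blockMul_right, h.crossGram_noise_final hk,
      h.white k hk.le (l + 1) (by omega) (by omega), Nat.add_sub_cancel, ih (by omega)]
    simp

lemma crossGram_noise_self (h : LinearModel N G e x) {k : ℕ} (hk : k < N) :
    crossGram (e k) (x k) = crossGram (e k) (e k) := by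
  rcases Nat.eq_zero_or_pos k with rfl | hk0
  · rw [h.initial, crossGram_add_right, crossGram_blockMul_right, h.crossGram_noise_final hk]
    simp
  · rw [h.step k hk0 hk, crossGram_add_right, crossGram_add_right,
      crossGram_blockMul_right, crossGram_blockMul_right, h.crossGram_noise_final hk,
      h.crossGram_noise_state hk (by omega)]
    simp

/-- Unrolling the recursion from `b` down to `j` leaves a combination of the noises at times `j + 1,
…, b`, all of which are orthogonal to `x N` and to the states up to time `j`. -/
lemma exists_residual (h : LinearModel N G e x) {j b : ℕ} (hjb : j ≤ b) (hb : b < N) :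
    ∃ M M' : Matrix (Fin d) (Fin d) ℝ, ∀ l, l ≤ j ∨ l = N →
      crossGram (x b - (blockMul M (x j) + blockMul M' (x N))) (x l) = 0 := by
  induction b, hjb using Nat.le_induction with
  | base =>
    refine ⟨1, 0, fun l _ => ?_⟩
    rw [one_blockMul, zero_blockMul, add_zero, sub_self]
    ext; simp [crossGram]
  | succ b hjb ih =>
    obtain ⟨M, M', hM⟩ := ih (by omega)
    refine ⟨G (b + 1) b * M, G (b + 1) b * M' + G (b + 1) N, fun l hl => ?_⟩
    have hres : x (b + 1) - (blockMul (G (b + 1) b * M) (x j) +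
        blockMul (G (b + 1) b * M' + G (b + 1) N) (x N)) =
        blockMul (G (b + 1) b) (x b - (blockMul M (x j) + blockMul M' (x N))) + e (b + 1) := by
      rw [h.step (b + 1) (by omega) hb, mul_blockMul, add_blockMul, mul_blockMul, blockMul_sub,
        blockMul_add, Nat.add_sub_cancel]
      abel
    rw [hres, crossGram_add_left, crossGram_blockMul_left, hM l hl, mul_zero, zero_add]
    rcases hl with hl | rfl
    · exact h.crossGram_noise_state hb (by omega)
    · exact h.crossGram_noise_final hb

theorem condOrth (h : LinearModel N G e x) (j : ℕ) :
    CondOrth x ({N} ∪ {j}) (Set.Ico 0 N ∩ Set.Iio j) (Set.Ico 0 N ∩ Set.Ioi j) := by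
  rintro b ⟨⟨-, hb⟩, hjb⟩ i
  obtain ⟨M, M', hM⟩ := h.exists_residual (j := j) (le_of_lt hjb) hb
  refine ⟨(blockMul M (x j) + blockMul M' (x N)) i, ?_, fun k hk a => ?_⟩
  · exact Submodule.add_mem _ (blockMul_mem (by simp) _ _) (blockMul_mem (by simp) _ _)
  · refine crossGram_eq_zero_iff.1 (hM k ?_) i a
    simp only [Set.mem_union, Set.mem_inter_iff, Set.mem_Iio, Set.mem_singleton_iff] at hk
    omega

/-- The `k`-th block of the basis dual to the state sequence. -/
noncomputable def dual (G : ℕ → ℕ → Matrix (Fin d) (Fin d) ℝ) (e : ℕ → Fin d → H) (k : ℕ) :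
    Fin d → H :=
  blockMul (crossGram (e k) (e k))⁻¹ (e k) -
    blockMul ((G (k + 1) k)ᵀ * (crossGram (e (k + 1)) (e (k + 1)))⁻¹) (e (k + 1))

lemma crossGram_dual_self (h : LinearModel N G e x) {k : ℕ} (hk : k + 2 ≤ N) :
    crossGram (dual G e k) (x k) = 1 := by
  rw [dual, crossGram_sub_left, crossGram_blockMul_left, crossGram_blockMul_left,
    h.crossGram_noise_self (by omega), h.crossGram_noise_state (by omega) (by omega),
    Matrix.nonsing_inv_mul _ (h.indep.isUnit_crossGram (by omega))]
  simp

lemma crossGram_dual_final (h : LinearModel N G e x) {k : ℕ} (hk : k + 2 ≤ N) :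
    crossGram (dual G e k) (x N) = 0 := by
  rw [dual, crossGram_sub_left, crossGram_blockMul_left, crossGram_blockMul_left,
    h.crossGram_noise_final (by omega), h.crossGram_noise_final (by omega)]
  simp

/-- The second term of `dual` is chosen to make the case `l = k + 1` vanish: it cancels the
contribution that `x k` passes on to `x (k + 1)`. Later states inherit the zero through the
recursion, since their noises are orthogonal to `e k` and `e (k + 1)`. -/
lemma crossGram_dual_of_gt (h : LinearModel N G e x) {k : ℕ} (hk : k + 2 ≤ N) {l : ℕ}
    (hkl : k + 1 ≤ l) (hl : l < N) : crossGram (dual G e k) (x l) = 0 := by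
  induction l, hkl using Nat.le_induction with
  | base =>
    rw [h.step (k + 1) (by omega) (by omega), crossGram_add_right, crossGram_add_right,
      crossGram_blockMul_right, crossGram_blockMul_right, h.crossGram_dual_final hk,
      Nat.add_sub_cancel, h.crossGram_dual_self hk, dual, crossGram_sub_left,
      crossGram_blockMul_left, crossGram_blockMul_left,
      h.white k (by omega) (k + 1) (by omega) (by omega), mul_assoc,
      Matrix.nonsing_inv_mul _ (h.indep.isUnit_crossGram (by omega))]
    simp
  | succ l hkl ih =>
    rw [h.step (l + 1) (by omega) (by omega), crossGram_add_right, crossGram_add_right,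
      crossGram_blockMul_right, crossGram_blockMul_right, h.crossGram_dual_final hk,
      Nat.add_sub_cancel, ih (by omega), dual, crossGram_sub_left,
      crossGram_blockMul_left, crossGram_blockMul_left,
      h.white k (by omega) (l + 1) (by omega) (by omega),
      h.white (k + 1) (by omega) (l + 1) (by omega) (by omega)]
    simp

lemma crossGram_dual_of_ne (h : LinearModel N G e x) {k : ℕ} (hk : k + 2 ≤ N) {l : ℕ}
    (hl : l ≤ N) (hlk : l ≠ k) : crossGram (dual G e k) (x l) = 0 := by
  rcases hl.eq_or_lt with rfl | hl
  · exact h.crossGram_dual_final hk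
  rcases lt_or_gt_of_ne hlk with hlk | hlk
  · rw [dual, crossGram_sub_left, crossGram_blockMul_left, crossGram_blockMul_left,
      h.crossGram_noise_state (by omega) hlk, h.crossGram_noise_state (by omega) (by omega)]
    simp
  · exact h.crossGram_dual_of_gt hk hlk hl

/-- Only the coefficient of `x N` matters later, so the other three are left unspecified. -/
lemma exists_dual_eq (h : LinearModel N G e x) {k : ℕ} (hk1 : 1 ≤ k) (hk : k + 2 ≤ N) :
    ∃ A B C : Matrix (Fin d) (Fin d) ℝ, dual G e k =
      blockMul A (x (k - 1)) + blockMul B (x k) + blockMul C (x (k + 1)) +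
      blockMul ((G (k + 1) k)ᵀ * (crossGram (e (k + 1)) (e (k + 1)))⁻¹ * G (k + 1) N -
        (crossGram (e k) (e k))⁻¹ * G k N) (x N) := by
  have h1 : e k = x k - blockMul (G k (k - 1)) (x (k - 1)) - blockMul (G k N) (x N) := by
    rw [h.step k hk1 (by omega)]; abel
  have h2 : e (k + 1) = x (k + 1) - blockMul (G (k + 1) k) (x k) - blockMul (G (k + 1) N) (x N) := by
    rw [h.step (k + 1) (by omega) (by omega), Nat.add_sub_cancel]; abel
  set P := (crossGram (e k) (e k))⁻¹
  set Q := (G (k + 1) k)ᵀ * (crossGram (e (k + 1)) (e (k + 1)))⁻¹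
  refine ⟨-(P * G k (k - 1)), P + Q * G (k + 1) k, -Q, ?_⟩
  change blockMul P (e k) - blockMul Q (e (k + 1)) = _
  have hneg (M : Matrix (Fin d) (Fin d) ℝ) (v : Fin d → H) : blockMul (-M) v = -blockMul M v := by
    rw [← zero_sub, sub_blockMul, zero_blockMul, zero_sub]
  rw [h1, h2]
  simp only [blockMul_sub, add_blockMul, sub_blockMul, mul_blockMul, hneg]
  abel

theorem condOrth_iff (h : LinearModel N G e x) (hx : BlockIndep N x) {k₁ : ℕ} :
    (∀ j ∈ Set.Icc (k₁ + 1) N, CondOrth x ({k₁} ∪ {j}) (Set.Icc (k₁ + 1) N ∩ Set.Iio j)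
      (Set.Icc (k₁ + 1) N ∩ Set.Ioi j)) ↔
    ∀ k : ℕ, k₁ + 1 ≤ k → k + 2 ≤ N →
      (crossGram (e k) (e k))⁻¹ * G k N =
        (G (k + 1) k)ᵀ * (crossGram (e (k + 1)) (e (k + 1)))⁻¹ * G (k + 1) N := by
  constructor
  · intro hF k hk1 hk
    obtain ⟨A, B, C, hy⟩ := h.exists_dual_eq (by omega : 1 ≤ k) hk
    set D := (G (k + 1) k)ᵀ * (crossGram (e (k + 1)) (e (k + 1)))⁻¹ * G (k + 1) N -
      (crossGram (e k) (e k))⁻¹ * G k N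
    suffices hD0 : D = 0 from (sub_eq_zero.1 hD0).symm
    -- The `CM_F` property is needed only at time `k + 1` with future time `N`. The residual `x N -
    -- u` is then orthogonal to all states from `k₁` to `k + 1`, which include `x (k - 1)` because
    -- `k₁ + 1 ≤ k`.
    choose u hu hr using fun i => hF (k + 1) ⟨by omega, by omega⟩ N
      ⟨⟨by omega, le_rfl⟩, by simp only [Set.mem_Ioi]; omega⟩ i
    rw [Set.singleton_union] at hu
    obtain ⟨S, T, hST⟩ := exists_pair_of_mem_blockSpan hu
    have hw : ∀ l, k₁ ≤ l → l ≤ k + 1 → crossGram (x N - u) (x l) = 0 := by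
      intro l h1 h2
      refine crossGram_eq_zero_iff.2 fun i j => hr i l ?_ j
      simp only [Set.mem_union, Set.mem_inter_iff, Set.mem_Iio, Set.mem_Icc,
        Set.mem_singleton_iff]
      omega
    have hwu : crossGram (x N - u) u = 0 := by
      have := congrArg (crossGram (x N - u)) hST
      rw [this, crossGram_add_right, crossGram_blockMul_right, crossGram_blockMul_right,
        hw _ le_rfl (by omega), hw (k + 1) (by omega) le_rfl]
      simp
    have hyw : crossGram (dual G e k) (x N - u) = 0 := by
      rw [crossGram_sub_right, hST, crossGram_add_right, crossGram_blockMul_right,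
        crossGram_blockMul_right, h.crossGram_dual_final hk,
        h.crossGram_dual_of_ne hk (by omega) (by omega),
        h.crossGram_dual_of_ne hk (by omega) (by omega)]
      simp
    -- The dual block is orthogonal to the residual by duality. In its expansion by states every
    -- term but the one at `x N` is orthogonal to the residual too, so that term must vanish against
    -- it.
    have hDw : D * crossGram (x N - u) (x N - u) = 0 := by
      rw [hy, crossGram_add_left, crossGram_add_left, crossGram_add_left] at hyw
      simp only [crossGram_blockMul_left] at hyw
      rw [crossGram_eq_zero_comm.1 (hw (k - 1) (by omega) (by omega)),
        crossGram_eq_zero_comm.1 (hw k (by omega) (by omega)),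
        crossGram_eq_zero_comm.1 (hw (k + 1) (by omega) (by omega))] at hyw
      rw [crossGram_sub_left, crossGram_eq_zero_comm.1 hwu, sub_zero]
      simpa using hyw
    have hz : blockMul D (x N - u) = 0 := by
      apply eq_zero_of_crossGram_self
      rw [crossGram_blockMul_left, crossGram_blockMul_right, ← mul_assoc, hDw, zero_mul]
    refine hx.eq_zero_of_blockMul_mem (k := N) le_rfl (S := {k₁, k + 1}) ?_ ?_ (M := D) ?_
    · rintro l (rfl | rfl) <;> simp only [Set.mem_Iic] <;> omega
    · simp only [Set.mem_insert_iff, Set.mem_singleton_iff]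
      omega
    · intro i
      rw [blockMul_sub, sub_eq_zero] at hz
      rw [hz]
      exact Submodule.sum_mem _ fun b _ => Submodule.smul_mem _ _ (hu b)
  · rintro hC j ⟨hj1, hjN⟩ b ⟨⟨-, hbN⟩, hjb⟩ i
    simp only [Set.mem_Ioi] at hjb
    -- Project on all states from `k₁` to `j`; what remains is that only the two end blocks
    -- contribute to the projection.
    obtain ⟨u, hu, hr⟩ := exists_blockSpan_sub_orth x (Finset.Icc k₁ j) (x b i)
    have hr' : ∀ k ∈ ((Finset.Icc k₁ j : Finset ℕ) : Set ℕ), ∀ a, inner ℝ (x b i - u) (x k a) = 0 :=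
      fun k hk => hr k (by exact_mod_cast hk)
    refine ⟨u, ?_, fun k hk a => hr k ?_ a⟩
    · obtain ⟨c, hc⟩ := exists_sum_of_mem_blockSpan hu
      -- Under the condition the dual block at an interior `k` lies in the span projected upon, so
      -- it has the same inner product with `u` as with `x b i`. The former is the coefficient `c
      -- k`, the latter is zero since `b ≠ k`.
      have hc0 : ∀ k, k₁ < k → k < j → c k = 0 := by
        intro k h1 h2
        have hkN : k + 2 ≤ N := by omega
        ext a
        have hmem : dual G e k a ∈ blockSpan x (Finset.Icc k₁ j : Finset ℕ) := by
          obtain ⟨A, B, C, hy⟩ := h.exists_dual_eq (by omega : 1 ≤ k) hkN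
          rw [← hC k h1 hkN, sub_self, zero_blockMul, add_zero] at hy
          rw [hy]
          refine Submodule.add_mem _ (Submodule.add_mem _ ?_ ?_) ?_ <;>
            refine blockMul_mem ?_ _ _ <;> simp only [Finset.coe_Icc, Set.mem_Icc] <;> omega
        have h0 := inner_eq_zero_of_mem_blockSpan hr' hmem
        rw [inner_sub_left, real_inner_comm,
          crossGram_eq_zero_iff.1 (h.crossGram_dual_of_ne hkN hbN (by omega)) a i, zero_sub,
          neg_eq_zero, hc, sum_inner, Finset.sum_eq_single k, sum_inner,
          Finset.sum_eq_single a] at h0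
        · have h1 := congrFun (congrFun (h.crossGram_dual_self hkN) a) a
          rw [crossGram, Matrix.of_apply, Matrix.one_apply_eq] at h1
          rw [inner_smul_left, real_inner_comm, h1] at h0
          simpa using h0
        · intro a' _ ha
          have h1 := congrFun (congrFun (h.crossGram_dual_self hkN) a) a'
          rw [crossGram, Matrix.of_apply, Matrix.one_apply_ne ha.symm] at h1
          rw [inner_smul_left, real_inner_comm, h1, mul_zero]
        · simp
        · intro l hl hlk
          rw [Finset.mem_Icc] at hl
          rw [sum_inner]
          refine Finset.sum_eq_zero fun a' _ => ?_
          rw [inner_smul_left, real_inner_comm,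
            crossGram_eq_zero_iff.1 (h.crossGram_dual_of_ne hkN (by omega) hlk) a a', mul_zero]
        · intro hk
          exact absurd (Finset.mem_Icc.2 ⟨by omega, by omega⟩) hk
      rw [hc]
      refine Submodule.sum_mem _ fun k hk => Submodule.sum_mem _ fun a _ => ?_
      rw [Finset.mem_Icc] at hk
      by_cases hkj : k₁ < k ∧ k < j
      · rw [hc0 k hkj.1 hkj.2]; simp
      · refine Submodule.smul_mem _ _ (mem_blockSpan ?_ a)
        simp only [Set.mem_union, Set.mem_singleton_iff]
        omega
    · simp only [Set.mem_union, Set.mem_inter_iff, Set.mem_Iio, Set.mem_Icc,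
        Set.mem_singleton_iff] at hk
      rw [Finset.mem_Icc]
      omega

end LinearModel

/-! ### Construction of a model from the linear `CM_L` property -/

/-- The equations of the model, with noise orthogonal to the past and final states, force the
noise to be white and linearly independent. -/
theorem LinearModel.of_orth {N : ℕ} {G : ℕ → ℕ → Matrix (Fin d) (Fin d) ℝ} {e x : ℕ → Fin d → H}
    (hx : BlockIndep N x)
    (step : ∀ k, 1 ≤ k → k < N →
      x k = blockMul (G k (k - 1)) (x (k - 1)) + blockMul (G k N) (x N) + e k)
    (final : x N = e N) (initial : x 0 = blockMul (G 0 N) (x N) + e 0)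
    (orth : ∀ k < N, ∀ l, l < k ∨ l = N → crossGram (e k) (x l) = 0) : LinearModel N G e x := by
  have white : ∀ k < N, ∀ l, l < k ∨ l = N → crossGram (e k) (e l) = 0 := by
    intro k hk l hl
    have hNk := orth k hk N (Or.inr rfl)
    have hlk := orth k hk l hl
    rcases hl with hl | rfl
    · rcases Nat.eq_zero_or_pos l with rfl | hl0
      · rw [initial, crossGram_add_right, crossGram_blockMul_right, hNk] at hlk
        simpa using hlk
      · rw [step l hl0 (by omega), crossGram_add_right, crossGram_add_right,
          crossGram_blockMul_right, crossGram_blockMul_right, hNk,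
          orth k hk (l - 1) (by omega)] at hlk
        simpa using hlk
    · rwa [← final]
  have hNm : ∀ i, x N i ∈ blockSpan e (Set.Iic N) := fun i => by
    rw [final]; exact mem_blockSpan (Set.mem_Iic.2 le_rfl) i
  have hmul (M : Matrix (Fin d) (Fin d) ℝ) (v : Fin d → H)
      (hv : ∀ i, v i ∈ blockSpan e (Set.Iic N)) (i : Fin d) :
      blockMul M v i ∈ blockSpan e (Set.Iic N) :=
    Submodule.sum_mem _ fun b _ => Submodule.smul_mem _ _ (hv b)
  -- The recursion expresses the states by the noise, so independence of the states passes to the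
  -- noise.
  have hspan : ∀ k ≤ N, ∀ i, x k i ∈ blockSpan e (Set.Iic N) := by
    intro k
    induction k with
    | zero =>
      intro hk i
      rw [initial]
      exact Submodule.add_mem _ (hmul _ _ hNm i) (mem_blockSpan (Set.mem_Iic.2 hk) i)
    | succ k ih =>
      intro hk i
      rcases hk.eq_or_lt with hk' | hk'
      · rw [hk']; exact hNm i
      · rw [step (k + 1) (by omega) hk']
        exact Submodule.add_mem _ (Submodule.add_mem _ (hmul _ _ (ih (by omega)) i)
          (hmul _ _ hNm i)) (mem_blockSpan (Set.mem_Iic.2 hk) i)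
  refine ⟨hx.of_mem_blockSpan hspan, ?_, step, final, initial⟩
  intro i hi j hj hij
  rcases hi.eq_or_lt with rfl | hi
  · exact crossGram_eq_zero_comm.1 (white j (by omega) _ (Or.inr rfl))
  rcases hj.eq_or_lt with rfl | hj
  · exact white i hi _ (Or.inr rfl)
  rcases lt_or_gt_of_ne hij with hij | hij
  · exact crossGram_eq_zero_comm.1 (white j hj i (Or.inl hij))
  · exact white i hi j (Or.inl hij)

/-- If `x` has the `CM_L` property in the linear sense, it obeys a linear model. The noise of the
model is given by its defining equations. -/
theorem exists_linearModel {N : ℕ} {x : ℕ → Fin d → H} (hx : BlockIndep N x)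
    (hL : ∀ j ∈ Set.Ico 0 N,
      CondOrth x ({N} ∪ {j}) (Set.Ico 0 N ∩ Set.Iio j) (Set.Ico 0 N ∩ Set.Ioi j)) :
    ∃ G : ℕ → ℕ → Matrix (Fin d) (Fin d) ℝ, (N = 0 → G 0 N = 0) ∧ ∀ e : ℕ → Fin d → H,
      (∀ k, 1 ≤ k → k < N →
        x k = blockMul (G k (k - 1)) (x (k - 1)) + blockMul (G k N) (x N) + e k) →
      x N = e N → x 0 = blockMul (G 0 N) (x N) + e 0 → LinearModel N G e x := by
  have hstep (k : ℕ) : ∃ A B : Matrix (Fin d) (Fin d) ℝ, 1 ≤ k → k < N →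
      ∀ l, l < k ∨ l = N → crossGram (x k - (blockMul A (x (k - 1)) + blockMul B (x N))) (x l) = 0 := by
    by_cases hk : 1 ≤ k ∧ k < N
    · choose u hu hr using fun i => hL (k - 1) ⟨by omega, by omega⟩ k
        ⟨⟨by omega, hk.2⟩, by simp only [Set.mem_Ioi]; omega⟩ i
      rw [Set.union_comm, Set.singleton_union] at hu
      obtain ⟨A, B, hAB⟩ := exists_pair_of_mem_blockSpan hu
      refine ⟨A, B, fun _ _ l hl => ?_⟩
      rw [← hAB]
      refine crossGram_eq_zero_iff.2 fun i j => hr i l ?_ j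
      simp only [Set.mem_union, Set.mem_inter_iff, Set.mem_Iio, Set.mem_Ico,
        Set.mem_singleton_iff]
      omega
    · exact ⟨0, 0, fun h1 h2 => absurd ⟨h1, h2⟩ hk⟩
  choose A B hAB using hstep
  have hinit : ∃ C : Matrix (Fin d) (Fin d) ℝ, (N = 0 → C = 0) ∧
      (0 < N → crossGram (x 0 - blockMul C (x N)) (x N) = 0) := by
    -- For `N = 0` the two boundary equations concern the same vector and are compatible if the
    -- matrix is zero.
    rcases Nat.eq_zero_or_pos N with rfl | hN
    · exact ⟨0, by simp, by simp⟩
    choose u hu hr using fun i => exists_blockSpan_sub_orth x {N} (x 0 i)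
    have hu' : ∀ i, u i ∈ blockSpan x {N, N} := by simpa using hu
    obtain ⟨S, T, hST⟩ := exists_pair_of_mem_blockSpan hu'
    refine ⟨S + T, by omega, fun _ => ?_⟩
    rw [add_blockMul, ← hST]
    exact crossGram_eq_zero_iff.2 fun i j => hr i N (by simp) j
  obtain ⟨C, hC0, hC⟩ := hinit
  refine ⟨fun k l => if k = 0 then C else if l = N then B k else A k, by simpa using hC0,
    fun e he hN he0 => .of_orth hx he hN he0 fun k hk l hl => ?_⟩
  rcases Nat.eq_zero_or_pos k with rfl | hk0
  · obtain rfl : l = N := by omega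
    simp only [if_true] at he0
    rw [eq_sub_of_add_eq' he0.symm]
    exact hC hk
  · have h := he k hk0 hk
    simp only [show k ≠ 0 by omega, show k - 1 ≠ N by omega, if_true, if_false] at h
    rw [eq_sub_of_add_eq' h.symm]
    exact hAB k hk0 hk l hl

end LinearTheory

/-! ### Conditional independence and conditional expectations in `L²` -/

section CondIndep

variable {Ω : Type*} {mΩ : MeasurableSpace Ω} {P : Measure Ω}

lemma integral_mul_indicator_one {B : Set Ω} (hB : MeasurableSet B) (f : Ω → ℝ) :
    ∫ ω, f ω * B.indicator (fun _ => (1 : ℝ)) ω ∂P = ∫ ω in B, f ω ∂P := by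
  rw [← integral_indicator hB]
  congr 1 with ω
  by_cases h : ω ∈ B <;> simp [h]

lemma integral_sub_mul_of_memLp {f g h : Ω → ℝ} (hf : MemLp f 2 P) (hg : MemLp g 2 P)
    (hh : MemLp h 2 P) :
    ∫ ω, (f ω - g ω) * h ω ∂P = ∫ ω, f ω * h ω ∂P - ∫ ω, g ω * h ω ∂P := by
  simp_rw [sub_mul]
  exact integral_sub (hf.integrable_mul hh) (hg.integrable_mul hh)

lemma sup_eq_generateFrom_inter (m₁ m₂ : MeasurableSpace Ω) :
    m₁ ⊔ m₂ = MeasurableSpace.generateFrom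
      (Set.image2 (· ∩ ·) {s | MeasurableSet[m₁] s} {s | MeasurableSet[m₂] s}) := by
  apply le_antisymm
  · refine sup_le (fun s hs => ?_) (fun s hs => ?_)
    · exact MeasurableSpace.measurableSet_generateFrom
        ⟨s, hs, Set.univ, MeasurableSet.univ, Set.inter_univ s⟩
    · exact MeasurableSpace.measurableSet_generateFrom
        ⟨Set.univ, @MeasurableSet.univ _ m₁, s, hs, Set.univ_inter s⟩
  · refine MeasurableSpace.generateFrom_le ?_
    rintro _ ⟨s, hs, t, ht, rfl⟩
    exact @MeasurableSet.inter _ (m₁ ⊔ m₂) _ _ ((le_sup_left : m₁ ≤ m₁ ⊔ m₂) s hs)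
      ((le_sup_right : m₂ ≤ m₁ ⊔ m₂) t ht)

lemma isPiSystem_image2_inter (m₁ m₂ : MeasurableSpace Ω) :
    IsPiSystem (Set.image2 (· ∩ ·) {s | MeasurableSet[m₁] s} {s | MeasurableSet[m₂] s}) := by
  rintro _ ⟨s, hs, t, ht, rfl⟩ _ ⟨s', hs', t', ht', rfl⟩ -
  exact ⟨s ∩ s', @MeasurableSet.inter _ m₁ _ _ hs hs', t ∩ t', @MeasurableSet.inter _ m₂ _ _ ht ht',
    by simp only; ac_rfl⟩

lemma setIntegral_sup_eq_zero {m mR : MeasurableSpace Ω} (hm : m ≤ mΩ) (hR : mR ≤ mΩ)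
    {f : Ω → ℝ} (hf : Integrable f P)
    (h : ∀ C D, MeasurableSet[m] C → MeasurableSet[mR] D → ∫ ω in C ∩ D, f ω ∂P = 0)
    (B : Set Ω) (hB : MeasurableSet[m ⊔ mR] B) : ∫ ω in B, f ω ∂P = 0 := by
  have hle : m ⊔ mR ≤ mΩ := sup_le hm hR
  induction B, hB using MeasurableSpace.induction_on_inter (sup_eq_generateFrom_inter m mR)
    (isPiSystem_image2_inter m mR) with
  | empty => simp
  | basic s hs =>
    obtain ⟨C, hC, D, hD, rfl⟩ := hs
    exact h C D hC hD
  | compl s hs ih =>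
    have h1 := integral_add_compl (hle s hs) hf
    have h2 := h Set.univ Set.univ (@MeasurableSet.univ _ m) (@MeasurableSet.univ _ mR)
    rw [Set.univ_inter, setIntegral_univ] at h2
    linarith
  | iUnion s hd hs ih =>
    rw [integral_iUnion (fun i => hle _ (hs i)) hd hf.integrableOn]
    simp [ih]

variable [IsProbabilityMeasure P]

lemma integral_mul_eq_zero_of_setIntegral_eq_zero {m : MeasurableSpace Ω} (hm : m ≤ mΩ)
    {f g : Ω → ℝ} (hf : Integrable f P) (hg : StronglyMeasurable[m] g)
    (hfg : Integrable (f * g) P) (h : ∀ B, MeasurableSet[m] B → ∫ ω in B, f ω ∂P = 0) :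
    ∫ ω, f ω * g ω ∂P = 0 := by
  have h0 : (0 : Ω → ℝ) =ᵐ[P] P[f | m] :=
    ae_eq_condExp_of_forall_setIntegral_eq hm hf (fun _ _ _ => integrableOn_zero)
      (fun B hB _ => by simp [h B hB]) stronglyMeasurable_zero.aestronglyMeasurable
  have h1 : P[f * g | m] =ᵐ[P] 0 := by
    filter_upwards [condExp_mul_of_stronglyMeasurable_right hg hfg hf, h0] with ω h1 h2
    rw [h1, Pi.mul_apply, ← h2]
    simp
  calc ∫ ω, f ω * g ω ∂P = ∫ ω, (P[f * g | m]) ω ∂P := (integral_condExp hm).symm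
    _ = 0 := by rw [integral_congr_ae h1]; simp

lemma integral_mul_condExp {m : MeasurableSpace Ω} (hm : m ≤ mΩ) {f g : Ω → ℝ}
    (hf : MemLp f 2 P) (hg : MemLp g 2 P) :
    ∫ ω, f ω * (P[g | m]) ω ∂P = ∫ ω, (P[f | m]) ω * (P[g | m]) ω ∂P := by
  have h := condExp_mul_of_stronglyMeasurable_right (stronglyMeasurable_condExp (f := g) (m := m)
    (μ := P)) (hf.integrable_mul (hg.condExp one_le_two)) (hf.integrable one_le_two)
  calc ∫ ω, f ω * (P[g | m]) ω ∂P = ∫ ω, (P[f * P[g | m] | m]) ω ∂P := (integral_condExp hm).symm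
    _ = _ := integral_congr_ae h

/-- Conditional expectation is an orthogonal projection in `L²`, hence self-adjoint. -/
lemma integral_mul_condExp_comm {m : MeasurableSpace Ω} (hm : m ≤ mΩ) {f g : Ω → ℝ}
    (hf : MemLp f 2 P) (hg : MemLp g 2 P) :
    ∫ ω, f ω * (P[g | m]) ω ∂P = ∫ ω, (P[f | m]) ω * g ω ∂P := by
  rw [integral_mul_condExp hm hf hg]
  simp_rw [mul_comm _ (g _), mul_comm _ ((P[g | m]) _)]
  rw [integral_mul_condExp hm hg hf]

lemma memLp_indicator_one {B : Set Ω} (hB : MeasurableSet B) :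
    MemLp (B.indicator fun _ => (1 : ℝ)) 2 P :=
  (memLp_const 1).indicator hB

/-- Under conditional independence, the residual of a square integrable `m₁`-measurable function
is orthogonal to the square integrable `m₂`-measurable functions. -/
theorem CondIndepGiven.integral_sub_condExp_mul {m m₁ m₂ : MeasurableSpace Ω} (hm : m ≤ mΩ)
    (h₁ : m₁ ≤ mΩ) (h₂ : m₂ ≤ mΩ) (h : CondIndepGiven m m₁ m₂ P) {f g : Ω → ℝ}
    (hf : MemLp f 2 P) (hg : MemLp g 2 P) (hfm : StronglyMeasurable[m₁] f)
    (hgm : StronglyMeasurable[m₂] g) : ∫ ω, (f ω - (P[f | m]) ω) * g ω ∂P = 0 := by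
  have hfr : MemLp (f - P[f | m]) 2 P := hf.sub (hf.condExp one_le_two)
  refine integral_mul_eq_zero_of_setIntegral_eq_zero h₂ (f := f - P[f | m])
    (hfr.integrable one_le_two) hgm (hfr.integrable_mul hg) fun B hB => ?_
  have hI := memLp_indicator_one (P := P) (h₂ B hB)
  set b : Ω → ℝ := B.indicator fun _ => (1 : ℝ) with hb
  have hbr : MemLp (b - P[b | m]) 2 P := hI.sub (hI.condExp one_le_two)
  -- The hypothesis speaks of sets only, so functions are reached one at a time: first the residual
  -- of the indicator of `B` is shown orthogonal to `f`, then self-adjointness moves the residual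
  -- onto `f`, and finally `B` is replaced by `g`.
  have hz : ∫ ω, (b - P[b | m]) ω * f ω ∂P = 0 := by
    refine integral_mul_eq_zero_of_setIntegral_eq_zero h₁ (hbr.integrable one_le_two) hfm
      (hbr.integrable_mul hf) fun A hA => ?_
    have hA' := memLp_indicator_one (P := P) (h₁ A hA)
    rw [← integral_mul_indicator_one (h₁ A hA)]
    simp only [Pi.sub_apply]
    rw [integral_sub_mul_of_memLp hI (hI.condExp one_le_two) hA']
    simp_rw [mul_comm _ (A.indicator _ _)]
    rw [integral_mul_condExp hm hA' hI, sub_eq_zero]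
    calc ∫ ω, A.indicator (fun _ => (1 : ℝ)) ω * b ω ∂P
        = ∫ ω, (A ∩ B).indicator (fun _ => (1 : ℝ)) ω ∂P := by
          congr 1 with ω
          by_cases hA : ω ∈ A <;> by_cases hB : ω ∈ B <;> simp [hb, hA, hB]
      _ = ∫ ω, (P⟦A ∩ B | m⟧) ω ∂P := (integral_condExp hm).symm
      _ = _ := integral_congr_ae (h A B hA hB)
  rw [← integral_mul_indicator_one (h₂ B hB), ← hb]
  simp only [Pi.sub_apply] at hz ⊢
  rw [integral_sub_mul_of_memLp hI (hI.condExp one_le_two) hf, sub_eq_zero] at hz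
  rw [integral_sub_mul_of_memLp hf (hf.condExp one_le_two) hI, sub_eq_zero, ← integral_mul_condExp_comm hm hf hI]
  simpa only [mul_comm] using hz

lemma setIntegral_eq_zero_of_indep {m mR : MeasurableSpace Ω} (hm : m ≤ mΩ) (hR : mR ≤ mΩ)
    (hI : Indep m mR P) {f : Ω → ℝ} (hf : Integrable f P) (hfm : StronglyMeasurable[m] f)
    (h0 : ∫ ω, f ω ∂P = 0) {D : Set Ω} (hD : MeasurableSet[mR] D) : ∫ ω in D, f ω ∂P = 0 := by
  rw [← setIntegral_condExp hR hf hD,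
    setIntegral_congr_ae (g := fun _ => ∫ ω, f ω ∂P) (hR D hD)
      ((condExp_indep_eq hm hR hfm hI).mono fun _ h _ => h), h0]
  simp

/-- If `m₂` is generated by `m` together with information independent of `m` and `m₁`, then `m₁` and
`m₂` are conditionally independent given `m`. -/
theorem condIndepGiven_of_indep {m m₁ m₂ mR : MeasurableSpace Ω} (hm : m ≤ mΩ)
    (h₁ : m₁ ≤ mΩ) (hR : mR ≤ mΩ) (h₂ : m₂ ≤ m ⊔ mR) (hI : Indep (m ⊔ m₁) mR P) :
    CondIndepGiven m m₁ m₂ P := by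
  intro A B hA hB
  have hle : m ⊔ mR ≤ mΩ := sup_le hm hR
  have hA' := memLp_indicator_one (P := P) (h₁ A hA)
  have hB' := memLp_indicator_one (P := P) (hle B (h₂ B hB))
  set a : Ω → ℝ := A.indicator fun _ => (1 : ℝ) with ha
  set b : Ω → ℝ := B.indicator fun _ => (1 : ℝ) with hb
  have har : MemLp (a - P[a | m]) 2 P := hA'.sub (hA'.condExp one_le_two)
  -- On sets `C ∩ D` with `C` in `m` and `D` in `mR`: the residual cut off to `C` is `m ⊔
  -- m₁`-measurable with mean zero, so by independence its integral over `D` vanishes. These sets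
  -- form a π-system generating `m ⊔ mR`.
  have hzero : ∀ S, MeasurableSet[m ⊔ mR] S → ∫ ω in S, (a - P[a | m]) ω ∂P = 0 := by
    refine setIntegral_sup_eq_zero hm hR (har.integrable one_le_two) fun C D hC hD => ?_
    rw [Set.inter_comm, ← setIntegral_indicator (hm C hC)]
    refine setIntegral_eq_zero_of_indep (sup_le hm h₁) hR hI
      ((har.integrable one_le_two).indicator (hm C hC)) ?_ ?_ hD
    · refine StronglyMeasurable.indicator ?_ ((le_sup_left : m ≤ m ⊔ m₁) C hC)
      have ham : StronglyMeasurable[m₁] a := stronglyMeasurable_const.indicator hA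
      have hgm : StronglyMeasurable[m] (P[a | m]) := stronglyMeasurable_condExp
      exact (ham.mono le_sup_right).sub (hgm.mono le_sup_left)
    · rw [integral_indicator (hm C hC)]
      simp only [Pi.sub_apply]
      rw [integral_sub (hA'.integrable one_le_two).integrableOn integrable_condExp.integrableOn,
        setIntegral_condExp hm (hA'.integrable one_le_two) hC, sub_self]
  have hprod : (P[a * b | m]) =ᵐ[P] P[P[a | m] * b | m] := by
    have h0 : P[(a - P[a | m]) * b | m] =ᵐ[P] 0 := by
      refine (ae_eq_condExp_of_forall_setIntegral_eq hm (har.integrable_mul hB')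
        (fun _ _ _ => integrableOn_zero) (fun S hS _ => ?_)
        stronglyMeasurable_zero.aestronglyMeasurable).symm
      have hind : (a - P[a | m]) * b = B.indicator (a - P[a | m]) := by
        ext ω
        by_cases hω : ω ∈ B <;> simp [hb, hω]
      rw [hind, setIntegral_indicator (hle B (h₂ B hB)), hzero _
        (@MeasurableSet.inter _ (m ⊔ mR) _ _ ((le_sup_left : m ≤ m ⊔ mR) S hS) (h₂ B hB))]
      simp
    have h1 := condExp_sub (hA'.integrable_mul hB')
      ((hA'.condExp (m := m) one_le_two).integrable_mul hB') m
    rw [sub_mul] at h0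
    filter_upwards [h0, h1] with ω h0 h1
    rw [h0] at h1
    simp only [Pi.zero_apply, Pi.sub_apply] at h1
    linarith
  have hab : (A ∩ B).indicator (fun _ => (1 : ℝ)) = a * b := by
    ext ω
    by_cases hA : ω ∈ A <;> by_cases hB : ω ∈ B <;> simp [ha, hb, hA, hB]
  rw [hab]
  exact hprod.trans (condExp_mul_of_stronglyMeasurable_left stronglyMeasurable_condExp
    ((hA'.condExp one_le_two).integrable_mul hB') (hB'.integrable one_le_two))

end CondIndep

/-! ### From Gaussian sequences to blocks in `L²` -/

section Bridge

variable {Ω : Type*}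

lemma sigmaOf_le_of_measurable {m : MeasurableSpace Ω} {d : ℕ} {x : ℕ → Ω → Fin d → ℝ} {S : Set ℕ}
    (h : ∀ k ∈ S, ∀ i, Measurable fun ω => x k ω i) : sigmaOf x S ≤ m :=
  iSup₂_le fun k hk => (measurable_pi_iff.2 (h k hk)).comap_le

variable {mΩ : MeasurableSpace Ω} {P : Measure Ω} {d N : ℕ}

lemma measurable_comap_apply {ι : Type*} (f : ι → Ω → ℝ) (p : ι) :
    Measurable[MeasurableSpace.comap (fun ω p => f p ω) inferInstance] (f p) :=
  (measurable_pi_apply p).comp (comap_measurable fun ω p => f p ω)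

lemma sigmaOf_union (x : ℕ → Ω → Fin d → ℝ) (S T : Set ℕ) :
    sigmaOf x (S ∪ T) = sigmaOf x S ⊔ sigmaOf x T :=
  iSup_union

lemma measurable_sigmaOf (x : ℕ → Ω → Fin d → ℝ) {S : Set ℕ} {k : ℕ} (hk : k ∈ S) :
    Measurable[sigmaOf x S] (x k) :=
  (comap_measurable (x k)).mono (le_iSup₂ (f := fun i (_ : i ∈ S) =>
    MeasurableSpace.comap (x i) inferInstance) k hk) le_rfl

lemma measurable_sigmaOf_apply (x : ℕ → Ω → Fin d → ℝ) {S : Set ℕ} {k : ℕ} (hk : k ∈ S)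
    (i : Fin d) : Measurable[sigmaOf x S] fun ω => x k ω i :=
  (measurable_pi_apply i).comp (measurable_sigmaOf x hk)

open Classical in
/-- The components of a square integrable random vector, as elements of `L²`. -/
noncomputable def toL2 (P : Measure Ω) (v : Ω → Fin d → ℝ) : Fin d → Lp ℝ 2 P :=
  fun i => if h : MemLp (fun ω => v ω i) 2 P then h.toLp else 0

lemma coeFn_toL2 {v : Ω → Fin d → ℝ} {i : Fin d} (h : MemLp (fun ω => v ω i) 2 P) :
    toL2 P v i =ᵐ[P] fun ω => v ω i := by
  rw [toL2, dif_pos h]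
  exact h.coeFn_toLp

lemma toL2_congr {v w : Ω → Fin d → ℝ} (hv : ∀ i, MemLp (fun ω => v ω i) 2 P)
    (h : ∀ᵐ ω ∂P, v ω = w ω) : toL2 P v = toL2 P w := by
  ext1 i
  have hi : (fun ω => v ω i) =ᵐ[P] fun ω => w ω i := h.mono fun ω hω => congrFun hω i
  rw [toL2, toL2, dif_pos (hv i), dif_pos ((memLp_congr_ae hi).1 (hv i))]
  exact (MemLp.toLp_eq_toLp_iff _ _).2 hi

lemma memLp_mulVec (M : Matrix (Fin d) (Fin d) ℝ) {v : Ω → Fin d → ℝ}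
    (hv : ∀ i, MemLp (fun ω => v ω i) 2 P) (i : Fin d) :
    MemLp (fun ω => (M *ᵥ v ω) i) 2 P :=
  memLp_finsetSum (f := fun j ω => M i j * v ω j) Finset.univ fun j _ => (hv j).const_mul (M i j)

lemma toL2_add {v w : Ω → Fin d → ℝ} (hv : ∀ i, MemLp (fun ω => v ω i) 2 P)
    (hw : ∀ i, MemLp (fun ω => w ω i) 2 P) :
    toL2 P (fun ω => v ω + w ω) = toL2 P v + toL2 P w := by
  ext1 i
  rw [Pi.add_apply, toL2, toL2, toL2, dif_pos (hv i), dif_pos (hw i),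
    dif_pos (show MemLp (fun ω => (v ω + w ω) i) 2 P from (hv i).add (hw i))]
  exact MemLp.toLp_add (hv i) (hw i)

lemma toL2_mulVec (M : Matrix (Fin d) (Fin d) ℝ) {v : Ω → Fin d → ℝ}
    (hv : ∀ i, MemLp (fun ω => v ω i) 2 P) :
    toL2 P (fun ω => M *ᵥ v ω) = blockMul M (toL2 P v) := by
  ext1 i
  refine Lp.ext ?_
  have h1 : ∀ᵐ ω ∂P, ∀ j ∈ Finset.univ, (M i j • toL2 P v j : Lp ℝ 2 P) ω = M i j * v ω j := by
    refine (Filter.eventually_all_finset _).2 fun j _ => ?_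
    filter_upwards [Lp.coeFn_smul (M i j) (toL2 P v j), coeFn_toL2 (hv j)] with ω h1 h2
    rw [h1, Pi.smul_apply, h2, smul_eq_mul]
  filter_upwards [coeFn_toL2 (memLp_mulVec M hv i), h1,
    Lp.coeFn_finsetSum Finset.univ (fun j => M i j • toL2 P v j)] with ω h2 h3 h4
  rw [h2, blockMul, h4, Finset.sum_apply]
  exact (Finset.sum_congr rfl h3).symm

lemma inner_toL2 {f : Lp ℝ 2 P} {F : Ω → ℝ} (hf : f =ᵐ[P] F) {w : Ω → Fin d → ℝ} {j : Fin d}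
    (hw : MemLp (fun ω => w ω j) 2 P) : inner ℝ f (toL2 P w j) = ∫ ω, F ω * w ω j ∂P := by
  rw [L2.inner_def]
  refine integral_congr_ae ?_
  filter_upwards [hf, coeFn_toL2 hw] with ω h1 h2
  rw [h1, h2]
  simp [mul_comm]

lemma covariance_eq_inner_toL2 [IsProbabilityMeasure P] {f : Lp ℝ 2 P} {F : Ω → ℝ}
    (hf : f =ᵐ[P] F) {w : Ω → Fin d → ℝ} {j : Fin d} (hw : MemLp (fun ω => w ω j) 2 P)
    (hw0 : ∫ ω, w ω j ∂P = 0) :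
    cov[F, fun ω => w ω j; P] = inner ℝ f (toL2 P w j) := by
  rw [inner_toL2 hf hw, covariance_eq_sub ((memLp_congr_ae hf).1 (Lp.memLp f)) hw, hw0, mul_zero,
    sub_zero]
  rfl

lemma covMatrix_eq_crossGram [IsProbabilityMeasure P] {v w : Ω → Fin d → ℝ}
    (hv : ∀ i, MemLp (fun ω => v ω i) 2 P) (hw : ∀ i, MemLp (fun ω => w ω i) 2 P)
    (hw0 : ∀ i, ∫ ω, w ω i ∂P = 0) : covMatrix P v w = crossGram (toL2 P v) (toL2 P w) := by
  ext i j
  exact covariance_eq_inner_toL2 (coeFn_toL2 (hv i)) (hw j) (hw0 j)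

/-- The blocks of `L²` functions given by a sequence of random vectors. -/
noncomputable def seqL2 (P : Measure Ω) (x : ℕ → Ω → Fin d → ℝ) : ℕ → Fin d → Lp ℝ 2 P :=
  fun k => toL2 P (x k)

/-- The values of a sequence at the times `0, …, N`. -/
def stack (N : ℕ) (x : ℕ → Ω → Fin d → ℝ) (ω : Ω) : Fin (N + 1) → Fin d → ℝ := fun k => x k ω

/-- The coordinate functionals of stacked sequences. -/
def stackCoord (k : Fin (N + 1)) (i : Fin d) : (Fin (N + 1) → Fin d → ℝ) →L[ℝ] ℝ :=
  (ContinuousLinearMap.proj (R := ℝ) (φ := fun _ : Fin d => ℝ) i).comp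
    (ContinuousLinearMap.proj (R := ℝ) (φ := fun _ : Fin (N + 1) => Fin d → ℝ) k)

lemma det_seqCov_ne_zero_iff [IsProbabilityMeasure P] {x : ℕ → Ω → Fin d → ℝ}
    (hx : ∀ k ≤ N, ∀ i, MemLp (fun ω => x k ω i) 2 P)
    (hx0 : ∀ k ≤ N, ∀ i, ∫ ω, x k ω i ∂P = 0) :
    (seqCov P N x).det ≠ 0 ↔ BlockIndep N (seqL2 P x) := by
  have : seqCov P N x =
      Matrix.gram ℝ fun p : Fin (N + 1) × Fin d => seqL2 P x p.1 p.2 := by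
    ext p q
    exact congrFun (congrFun (covMatrix_eq_crossGram (hx p.1 (Nat.lt_succ_iff.1 p.1.2))
      (hx q.1 (Nat.lt_succ_iff.1 q.1.2)) (hx0 q.1 (Nat.lt_succ_iff.1 q.1.2))) p.2) q.2
  rw [this, Matrix.det_gram_ne_zero_iff_linearIndependent]
  rfl

namespace IsZMNG

variable {x : ℕ → Ω → Fin d → ℝ}

lemma memLp (hx : IsZMNG P N x) {k : ℕ} (hk : k ≤ N) (i : Fin d) :
    MemLp (fun ω => x k ω i) 2 P :=
  ((hx.gaussian.eval (⟨k, Nat.lt_succ_of_le hk⟩ : Fin (N + 1))).eval i).memLp_two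

lemma blockIndep [IsProbabilityMeasure P] (hx : IsZMNG P N x) : BlockIndep N (seqL2 P x) :=
  (det_seqCov_ne_zero_iff (fun _ hk => hx.memLp hk) hx.zero_mean).1 hx.nonsingular

lemma integral_comp_stack (hx : IsZMNG P N x) (L : (Fin (N + 1) → Fin d → ℝ) →L[ℝ] ℝ) :
    ∫ ω, L (stack N x ω) ∂P = 0 := by
  have hint : Integrable (stack N x) P := hx.gaussian.integrable
  rw [L.integral_comp_comm hint]
  suffices h : ∫ ω, stack N x ω ∂P = 0 by rw [h, map_zero]
  ext k i
  rw [eval_integral (fun k => hint.eval k), eval_integral (fun i => (hint.eval k).eval i)]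
  exact hx.zero_mean k (Nat.lt_succ_iff.1 k.2) i

lemma sigmaOf_le (hx : IsZMNG P N x) {S : Set ℕ} (hS : S ⊆ Set.Iic N) : sigmaOf x S ≤ mΩ :=
  iSup₂_le fun k hk => (hx.measurable k (hS hk)).comap_le

/-- Elements of `L²` are only classes of functions. The representative chosen here is measurable for
the σ-algebra itself, without completion, and is linear in the sequence, so that joint Gaussianity
applies. -/
lemma exists_repr (hx : IsZMNG P N x) {S : Set ℕ} (hS : S ⊆ Set.Iic N) {u : Lp ℝ 2 P}
    (hu : u ∈ blockSpan (seqL2 P x) S) :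
    ∃ L : (Fin (N + 1) → Fin d → ℝ) →L[ℝ] ℝ,
      Measurable[sigmaOf x S] (fun ω => L (stack N x ω)) ∧ u =ᵐ[P] fun ω => L (stack N x ω) := by
  induction hu using Submodule.span_induction with
  | mem v hv =>
    obtain ⟨k, hk, i, rfl⟩ := hv
    have hkN : k ≤ N := hS hk
    exact ⟨stackCoord ⟨k, Nat.lt_succ_of_le hkN⟩ i,
      measurable_sigmaOf_apply x hk i, coeFn_toL2 (hx.memLp hkN i)⟩
  | zero => exact ⟨0, measurable_const, Lp.coeFn_zero ℝ 2 P⟩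
  | add u v _ _ h₁ h₂ =>
    obtain ⟨L₁, m₁, e₁⟩ := h₁
    obtain ⟨L₂, m₂, e₂⟩ := h₂
    refine ⟨L₁ + L₂, m₁.add m₂, ?_⟩
    filter_upwards [Lp.coeFn_add u v, e₁, e₂] with ω h h₁ h₂
    rw [h, Pi.add_apply, h₁, h₂]; rfl
  | smul c u _ h₁ =>
    obtain ⟨L₁, m₁, e₁⟩ := h₁
    refine ⟨c • L₁, m₁.const_mul c, ?_⟩
    filter_upwards [Lp.coeFn_smul c u, e₁] with ω h h₁
    rw [h, Pi.smul_apply, h₁]; rfl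

/-- Linear functionals of the sequence that are orthogonal to some of its values are jointly
independent of these values. -/
lemma indep_of_orth [IsProbabilityMeasure P] (hx : IsZMNG P N x) {ι : Type*} [Finite ι]
    {L : ι → (Fin (N + 1) → Fin d → ℝ) →L[ℝ] ℝ} {r : ι → Lp ℝ 2 P}
    (hr : ∀ p, r p =ᵐ[P] fun ω => L p (stack N x ω)) {T : Set ℕ} (hT : T ⊆ Set.Iic N)
    (horth : ∀ p, ∀ k ∈ T, ∀ j, inner ℝ (r p) (seqL2 P x k j) = 0) :
    Indep (sigmaOf x T) (MeasurableSpace.comap (fun ω p => L p (stack N x ω)) inferInstance) P := by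
  have := Fintype.ofFinite ι
  let κ := {k : Fin (N + 1) // (k : ℕ) ∈ T} × Fin d
  have := Fintype.ofFinite κ
  let Φ : (Fin (N + 1) → Fin d → ℝ) →L[ℝ] (ι → ℝ) × (κ → ℝ) :=
    (ContinuousLinearMap.pi L).prod (ContinuousLinearMap.pi fun q : κ => stackCoord q.1.1 q.2)
  have hG : HasGaussianLaw (Φ ∘ stack N x) P := hx.gaussian.map Φ
  have hI := HasGaussianLaw.indepFun_of_covariance_eval (X := fun p ω => L p (stack N x ω))
    (Y := fun (q : κ) ω => x q.1.1 ω q.2) hG fun p q => by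
      rw [covariance_eq_inner_toL2 (hr p) (hx.memLp (hT q.1.2) q.2)
        (hx.zero_mean _ (hT q.1.2) q.2)]
      exact horth p _ q.1.2 q.2
  refine indep_of_indep_of_le_left (Indep.symm hI) (sigmaOf_le_of_measurable fun k hk i => ?_)
  have hkN : k ≤ N := hT hk
  exact measurable_comap_apply (fun (q : κ) ω => x q.1.1 ω q.2)
    (⟨⟨k, Nat.lt_succ_of_le hkN⟩, hk⟩, i)

theorem condOrth_of_condIndepGiven [IsProbabilityMeasure P] (hx : IsZMNG P N x) {S A B : Set ℕ}
    (hS : S ⊆ Set.Iic N) (hA : A ⊆ Set.Iic N) (hB : B ⊆ Set.Iic N)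
    (h : CondIndepGiven (sigmaOf x S) (sigmaOf x A) (sigmaOf x B) P) :
    CondOrth (seqL2 P x) S A B := by
  intro b hb i
  obtain ⟨u, hu, hr⟩ := exists_blockSpan_sub_orth (seqL2 P x)
    ((Set.finite_Iic N).subset hS).toFinset (seqL2 P x b i)
  simp only [Set.Finite.coe_toFinset, Set.Finite.mem_toFinset] at hu hr
  refine ⟨u, hu, ?_⟩
  rintro a (ha | ha) j
  swap
  · exact hr a ha j
  have hbN : b ≤ N := hB hb
  have haN : a ≤ N := hA ha
  obtain ⟨L, hLm, hL⟩ := hx.exists_repr hS hu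
  let K : (Fin (N + 1) → Fin d → ℝ) →L[ℝ] ℝ :=
    stackCoord ⟨b, Nat.lt_succ_of_le hbN⟩ i
  have hK : seqL2 P x b i - u =ᵐ[P] fun ω => (K - L) (stack N x ω) := by
    filter_upwards [Lp.coeFn_sub (seqL2 P x b i) u, coeFn_toL2 (hx.memLp hbN i), hL]
      with ω h1 h2 h3
    rw [h1, Pi.sub_apply, h3, seqL2, h2]; rfl
  have hI := hx.indep_of_orth (ι := Unit) (L := fun _ => K - L) (fun _ => hK) hS fun _ => hr
  have hSm := hx.sigmaOf_le hS
  have hRm : StronglyMeasurable[MeasurableSpace.comap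
      (fun ω (_ : Unit) => (K - L) (stack N x ω)) inferInstance]
      (fun ω => (K - L) (stack N x ω)) :=
    (measurable_comap_apply (fun (_ : Unit) ω => (K - L) (stack N x ω)) ()).stronglyMeasurable
  have hstack : Measurable (stack N x) :=
    measurable_pi_iff.2 fun k => hx.measurable k (Nat.lt_succ_iff.1 k.2)
  have hle : MeasurableSpace.comap
      (fun ω (_ : Unit) => (K - L) (stack N x ω)) inferInstance ≤ mΩ :=
    (measurable_pi_iff.2 fun _ => (K - L).measurable.comp hstack).comap_le
  have hR0 := condExp_indep_eq hle hSm hRm (Indep.symm hI)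
  rw [hx.integral_comp_stack] at hR0
  have hbm := hx.memLp hbN i
  have hLint : MemLp (fun ω => L (stack N x ω)) 2 P := (memLp_congr_ae hL).1 (Lp.memLp u)
  -- The residual is independent of the conditioning σ-algebra and has mean zero, so the conditional
  -- expectation is the linear projection.
  have hce : P[fun ω => x b ω i | sigmaOf x S] =ᵐ[P] fun ω => L (stack N x ω) := by
    have h1 := condExp_sub (m := sigmaOf x S) (hbm.integrable one_le_two)
      (hLint.integrable one_le_two)
    rw [condExp_of_stronglyMeasurable hSm hLm.stronglyMeasurable
      (hLint.integrable one_le_two)] at h1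
    filter_upwards [h1, hR0] with ω h1 h2
    have h3 := h1.symm.trans h2
    rw [Pi.sub_apply] at h3
    linarith
  have hsymm : CondIndepGiven (sigmaOf x S) (sigmaOf x B) (sigmaOf x A) P := fun F F' hF hF' => by
    rw [Set.inter_comm, mul_comm]; exact h F' F hF' hF
  have h0 := hsymm.integral_sub_condExp_mul hSm (hx.sigmaOf_le hB) (hx.sigmaOf_le hA) hbm
    (hx.memLp haN j) (measurable_sigmaOf_apply x hb i).stronglyMeasurable
    (measurable_sigmaOf_apply x ha j).stronglyMeasurable
  refine (inner_toL2 hK (hx.memLp haN j)).trans (Eq.trans ?_ h0)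
  refine integral_congr_ae ?_
  filter_upwards [hce] with ω h1
  rw [h1]; rfl

theorem condIndepGiven_of_condOrth [IsProbabilityMeasure P] (hx : IsZMNG P N x) {S A B : Set ℕ}
    (hS : S ⊆ Set.Iic N) (hA : A ⊆ Set.Iic N) (hB : B ⊆ Set.Iic N)
    (h : CondOrth (seqL2 P x) S A B) :
    CondIndepGiven (sigmaOf x S) (sigmaOf x A) (sigmaOf x B) P := by
  let ι := {k : Fin (N + 1) // (k : ℕ) ∈ B} × Fin d
  choose u hu hr using fun p : ι => h p.1.1 p.1.2 p.2
  choose L hLm hL using fun p : ι => hx.exists_repr hS (hu p)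
  let K (p : ι) : (Fin (N + 1) → Fin d → ℝ) →L[ℝ] ℝ := stackCoord p.1.1 p.2
  have hK (p : ι) : seqL2 P x p.1.1 p.2 - u p =ᵐ[P] fun ω => (K p - L p) (stack N x ω) := by
    filter_upwards [Lp.coeFn_sub (seqL2 P x p.1.1 p.2) (u p),
      coeFn_toL2 (hx.memLp (hB p.1.2) p.2), hL p] with ω h1 h2 h3
    rw [h1, Pi.sub_apply, h3, seqL2, h2]; rfl
  -- All residuals together are independent of the blocks in `A ∪ S`, and each component of a block
  -- in `B` is the sum of a function of the `S`-blocks and a residual. This is the situation of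
  -- `condIndepGiven_of_indep`.
  have hI := hx.indep_of_orth (L := fun p => K p - L p) hK (Set.union_subset hA hS) hr
  have hstack : Measurable (stack N x) :=
    measurable_pi_iff.2 fun k => hx.measurable k (Nat.lt_succ_iff.1 k.2)
  rw [sigmaOf_union, sup_comm] at hI
  have hle : MeasurableSpace.comap
      (fun ω p => (K p - L p) (stack N x ω)) inferInstance ≤ mΩ :=
    (measurable_pi_iff.2 fun p => (K p - L p).measurable.comp hstack).comap_le
  refine condIndepGiven_of_indep (hx.sigmaOf_le hS) (hx.sigmaOf_le hA) hle ?_ hI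
  refine sigmaOf_le_of_measurable fun b hb i => ?_
  have hbN : b ≤ N := hB hb
  let p : ι := (⟨⟨b, Nat.lt_succ_of_le hbN⟩, hb⟩, i)
  have h1 : (fun ω => x b ω i) =
      (fun ω => L p (stack N x ω)) + fun ω => (K p - L p) (stack N x ω) := by
    ext ω
    exact (add_sub_cancel (L p (stack N x ω)) (x b ω i)).symm
  rw [h1]
  exact Measurable.add ((hLm p).mono le_sup_left le_rfl)
    ((measurable_comap_apply (fun p ω => (K p - L p) (stack N x ω)) p).mono le_sup_right le_rfl)

theorem condIndepGiven_iff [IsProbabilityMeasure P] (hx : IsZMNG P N x) {S A B : Set ℕ}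
    (hS : S ⊆ Set.Iic N) (hA : A ⊆ Set.Iic N) (hB : B ⊆ Set.Iic N) :
    CondIndepGiven (sigmaOf x S) (sigmaOf x A) (sigmaOf x B) P ↔ CondOrth (seqL2 P x) S A B :=
  ⟨hx.condOrth_of_condIndepGiven hS hA hB, hx.condIndepGiven_of_condOrth hS hA hB⟩

theorem isMarkovGiven_iff [IsProbabilityMeasure P] (hx : IsZMNG P N x) {n : ℕ} (hn : n ≤ N)
    {s : Set ℕ} (hs : s ⊆ Set.Iic N) :
    IsMarkovGiven (sigmaOf x {n}) P x s ↔
      ∀ j ∈ s, CondOrth (seqL2 P x) ({n} ∪ {j}) (s ∩ Set.Iio j) (s ∩ Set.Ioi j) := by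
  refine forall₂_congr fun j hj => ?_
  rw [← sigmaOf_union]
  refine hx.condIndepGiven_iff ?_ (Set.inter_subset_left.trans hs) (Set.inter_subset_left.trans hs)
  rintro k (rfl | rfl)
  exacts [hn, hs hj]

end IsZMNG

end Bridge

/-! ### From the probabilistic model to the linear model and back -/

section Model

variable {Ω : Type*} [MeasurableSpace Ω] {P : Measure Ω} {d N : ℕ}

lemma toL2_eq_blockMul_add {u v w : Ω → Fin d → ℝ} {M : Matrix (Fin d) (Fin d) ℝ}
    (hu : ∀ i, MemLp (fun ω => u ω i) 2 P) (hv : ∀ i, MemLp (fun ω => v ω i) 2 P)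
    (hw : ∀ i, MemLp (fun ω => w ω i) 2 P) (h : ∀ᵐ ω ∂P, u ω = M *ᵥ v ω + w ω) :
    toL2 P u = blockMul M (toL2 P v) + toL2 P w := by
  rw [toL2_congr hu h, toL2_add (memLp_mulVec M hv) hw, toL2_mulVec M hv]

lemma toL2_eq_blockMul_add_blockMul_add {u v v' w : Ω → Fin d → ℝ}
    {M M' : Matrix (Fin d) (Fin d) ℝ} (hu : ∀ i, MemLp (fun ω => u ω i) 2 P)
    (hv : ∀ i, MemLp (fun ω => v ω i) 2 P) (hv' : ∀ i, MemLp (fun ω => v' ω i) 2 P)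
    (hw : ∀ i, MemLp (fun ω => w ω i) 2 P)
    (h : ∀ᵐ ω ∂P, u ω = M *ᵥ v ω + M' *ᵥ v' ω + w ω) :
    toL2 P u = blockMul M (toL2 P v) + blockMul M' (toL2 P v') + toL2 P w := by
  have hm' := memLp_mulVec M' hv'
  rw [toL2_eq_blockMul_add (w := fun ω => M' *ᵥ v' ω + w ω) hu hv (fun i => (hm' i).add (hw i))
    (h.mono fun ω hω => by rw [hω, add_assoc]), toL2_add hm' hw, toL2_mulVec M' hv', add_assoc]

namespace ObeysCMLModel

variable {G : ℕ → ℕ → Matrix (Fin d) (Fin d) ℝ} {e x : ℕ → Ω → Fin d → ℝ}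

theorem linearModel [IsProbabilityMeasure P] (h : ObeysCMLModel P N G e x) (hx : IsZMNG P N x) :
    LinearModel N G (seqL2 P e) (seqL2 P x) where
  indep := h.noise.blockIndep
  white i hi j hj hij := by
    have := h.white i hi j hj hij
    rwa [covMatrix_eq_crossGram (h.noise.memLp hi) (h.noise.memLp hj) (h.noise.zero_mean j hj)]
      at this
  step k hk1 hk := toL2_eq_blockMul_add_blockMul_add (hx.memLp hk.le) (hx.memLp (by omega))
    (hx.memLp le_rfl) (h.noise.memLp hk.le) (h.step k hk1 hk)
  final := toL2_congr (hx.memLp le_rfl) h.final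
  initial := toL2_eq_blockMul_add (hx.memLp (Nat.zero_le N)) (hx.memLp le_rfl)
    (h.noise.memLp (Nat.zero_le N)) h.initial

lemma covMatrix_noise [IsProbabilityMeasure P] (h : ObeysCMLModel P N G e x) {k : ℕ}
    (hk : k ≤ N) :
    covMatrix P (e k) (e k) = crossGram (seqL2 P e k) (seqL2 P e k) :=
  covMatrix_eq_crossGram (h.noise.memLp hk) (h.noise.memLp hk) (h.noise.zero_mean k hk)

end ObeysCMLModel

/-- The noise that turns a sequence into a solution of the `CM_L` model with given matrices. -/
noncomputable def modelNoise (N : ℕ) (G : ℕ → ℕ → Matrix (Fin d) (Fin d) ℝ)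
    (x : ℕ → Ω → Fin d → ℝ) (k : ℕ) (ω : Ω) : Fin d → ℝ :=
  if k = N then x N ω
  else if k = 0 then x 0 ω - G 0 N *ᵥ x N ω
  else x k ω - (G k (k - 1) *ᵥ x (k - 1) ω + G k N *ᵥ x N ω)

/-- The coordinate blocks of stacked sequences. -/
def stackProj (k : Fin (N + 1)) : (Fin (N + 1) → Fin d → ℝ) →L[ℝ] (Fin d → ℝ) :=
  ContinuousLinearMap.proj (R := ℝ) (φ := fun _ : Fin (N + 1) => Fin d → ℝ) k

omit [MeasurableSpace Ω] in
lemma exists_modelNoise_eq (G : ℕ → ℕ → Matrix (Fin d) (Fin d) ℝ) (x : ℕ → Ω → Fin d → ℝ) {k : ℕ}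
    (hk : k ≤ N) : ∃ L : (Fin (N + 1) → Fin d → ℝ) →L[ℝ] (Fin d → ℝ),
      ∀ ω, modelNoise N G x k ω = L (stack N x ω) := by
  let m (M : Matrix (Fin d) (Fin d) ℝ) : (Fin d → ℝ) →L[ℝ] (Fin d → ℝ) :=
    M.mulVecLin.toContinuousLinearMap
  have hpos : ∀ {l : ℕ}, l ≤ N → l < N + 1 := fun h => Nat.lt_succ_of_le h
  by_cases h1 : k = N
  · exact ⟨stackProj ⟨N, hpos le_rfl⟩, fun ω => by rw [modelNoise, if_pos h1]; rfl⟩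
  by_cases h2 : k = 0
  · refine ⟨stackProj ⟨0, hpos (Nat.zero_le N)⟩ - (m (G 0 N)).comp (stackProj ⟨N, hpos le_rfl⟩),
      fun ω => ?_⟩
    rw [modelNoise, if_neg h1, if_pos h2]; rfl
  · refine ⟨stackProj ⟨k, hpos hk⟩ -
      ((m (G k (k - 1))).comp (stackProj ⟨k - 1, hpos ((Nat.sub_le k 1).trans hk)⟩) +
        (m (G k N)).comp (stackProj ⟨N, hpos le_rfl⟩)), fun ω => ?_⟩
    rw [modelNoise, if_neg h1, if_neg h2]; rfl

theorem IsZMNG.exists_obeysCMLModel [IsProbabilityMeasure P] {x : ℕ → Ω → Fin d → ℝ}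
    (hx : IsZMNG P N x) (hL : IsCML P 0 N x) :
    ∃ (G : ℕ → ℕ → Matrix (Fin d) (Fin d) ℝ) (e : ℕ → Ω → Fin d → ℝ), ObeysCMLModel P N G e x := by
  -- The linear theory supplies only the matrices. The noise is then defined pointwise by the model
  -- equations, hence is a linear image of the sequence and jointly Gaussian; `hG` gives whiteness
  -- and independence of its classes in `L²`.
  obtain ⟨G, hG0, hG⟩ := exists_linearModel hx.blockIndep
    ((hx.isMarkovGiven_iff le_rfl fun k hk => Set.mem_Iic.2 hk.2.le).1 hL)
  refine ⟨G, modelNoise N G x, ?_⟩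
  have hstep : ∀ k, 1 ≤ k → k < N → ∀ ω, x k ω =
      G k (k - 1) *ᵥ x (k - 1) ω + G k N *ᵥ x N ω + modelNoise N G x k ω := by
    intro k h1 h2 ω
    rw [modelNoise, if_neg (by omega), if_neg (by omega)]
    abel
  have hfinal : ∀ ω, x N ω = modelNoise N G x N ω := fun ω => by rw [modelNoise, if_pos rfl]
  have hinit : ∀ ω, x 0 ω = G 0 N *ᵥ x N ω + modelNoise N G x 0 ω := by
    intro ω
    rcases Nat.eq_zero_or_pos N with rfl | hN
    -- With `N = 0` the noise at time `0` is `x 0` itself, so the initial equation needs `G 0 N =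
    -- 0`.
    · rw [← hfinal, hG0 rfl]; simp
    · rw [modelNoise, if_neg (by omega), if_pos rfl]; abel
  choose L hLe using fun k : Fin (N + 1) =>
    exists_modelNoise_eq G x (Nat.lt_succ_iff.1 k.2)
  have hgauss : HasGaussianLaw (fun ω (k : Fin (N + 1)) => modelNoise N G x k ω) P := by
    have h := HasGaussianLaw.map (F := Fin (N + 1) → Fin d → ℝ) hx.gaussian
      (ContinuousLinearMap.pi L)
    refine h.congr (Filter.Eventually.of_forall fun ω => ?_)
    exact funext fun k => (hLe k ω).symm
  have hmean : ∀ k ≤ N, ∀ i : Fin d, ∫ ω, modelNoise N G x k ω i ∂P = 0 := by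
    intro k hk i
    have h := hx.integral_comp_stack
      ((ContinuousLinearMap.proj (R := ℝ) (φ := fun _ : Fin d => ℝ) i).comp
        (L ⟨k, Nat.lt_succ_of_le hk⟩))
    rw [← h]
    exact integral_congr_ae (Filter.Eventually.of_forall fun ω =>
      congrFun (hLe ⟨k, Nat.lt_succ_of_le hk⟩ ω) i)
  have hmem : ∀ k ≤ N, ∀ i, MemLp (fun ω => modelNoise N G x k ω i) 2 P := fun k hk i =>
    ((hgauss.eval (⟨k, Nat.lt_succ_of_le hk⟩ : Fin (N + 1))).eval i).memLp_two
  have hmeas : ∀ k ≤ N, Measurable (modelNoise N G x k) := by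
    intro k hk
    have hstack : Measurable (stack N x) :=
      measurable_pi_iff.2 fun k => hx.measurable k (Nat.lt_succ_iff.1 k.2)
    rw [funext (hLe ⟨k, Nat.lt_succ_of_le hk⟩)]
    exact (L _).measurable.comp hstack
  have hM : LinearModel N G (seqL2 P (modelNoise N G x)) (seqL2 P x) := by
    refine hG _ (fun k h1 h2 => ?_) ?_ ?_
    · exact toL2_eq_blockMul_add_blockMul_add (hx.memLp h2.le) (hx.memLp (by omega))
        (hx.memLp le_rfl) (hmem k h2.le) (.of_forall (hstep k h1 h2))
    · exact toL2_congr (hx.memLp le_rfl) (.of_forall hfinal)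
    · exact toL2_eq_blockMul_add (hx.memLp (Nat.zero_le N)) (hx.memLp le_rfl)
        (hmem 0 (Nat.zero_le N)) (.of_forall hinit)
  refine ⟨⟨hmeas, hgauss, hmean, (det_seqCov_ne_zero_iff hmem hmean).2 hM.indep⟩, ?_,
    fun k h1 h2 => .of_forall (hstep k h1 h2), .of_forall hfinal, .of_forall hinit⟩
  intro i hi j hj hij
  rw [covMatrix_eq_crossGram (hmem i hi) (hmem j hj) (hmean j hj)]
  exact hM.white i hi j hj hij

end Model

end CMSeq

theorem mainTheorem5 {Ω : Type*} [MeasurableSpace Ω] (P : Measure Ω) [IsProbabilityMeasure P]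
    (d N k₁ : ℕ) (hk₁ : k₁ ≤ N) (x : ℕ → Ω → Fin d → ℝ) (hx : CMSeq.IsZMNG P N x) :
    (CMSeq.IsCML P 0 N x ∧ CMSeq.IsCMF P k₁ N x) ↔
      ∃ (G : ℕ → ℕ → Matrix (Fin d) (Fin d) ℝ) (e : ℕ → Ω → Fin d → ℝ),
        CMSeq.ObeysCMLModel P N G e x ∧
        ∀ k : ℕ, k₁ + 1 ≤ k → k + 2 ≤ N →
          (CMSeq.covMatrix P (e k) (e k))⁻¹ * G k N =
            (G (k + 1) k)ᵀ * (CMSeq.covMatrix P (e (k + 1)) (e (k + 1)))⁻¹ * G (k + 1) N := by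
  have hF : ∀ (G : ℕ → ℕ → Matrix (Fin d) (Fin d) ℝ) (e : ℕ → Ω → Fin d → ℝ),
      CMSeq.ObeysCMLModel P N G e x → (CMSeq.IsCMF P k₁ N x ↔ ∀ k : ℕ, k₁ + 1 ≤ k → k + 2 ≤ N →
        (CMSeq.covMatrix P (e k) (e k))⁻¹ * G k N =
          (G (k + 1) k)ᵀ * (CMSeq.covMatrix P (e (k + 1)) (e (k + 1)))⁻¹ * G (k + 1) N) := by
    intro G e h
    rw [CMSeq.IsCMF, hx.isMarkovGiven_iff hk₁ (fun k hk => Set.mem_Iic.2 hk.2),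
      (h.linearModel hx).condOrth_iff hx.blockIndep]
    refine forall_congr' fun k => forall₂_congr fun _ hk => ?_
    rw [h.covMatrix_noise (k := k) (by omega), h.covMatrix_noise (k := k + 1) (by omega)]
  constructor
  · rintro ⟨hL, hF'⟩
    obtain ⟨G, e, h⟩ := hx.exists_obeysCMLModel hL
    exact ⟨G, e, h, (hF G e h).1 hF'⟩
  · rintro ⟨G, e, h, hC⟩
    refine ⟨?_, (hF G e h).2 hC⟩
    exact (hx.isMarkovGiven_iff le_rfl fun k hk => Set.mem_Iic.2 hk.2.le).2 fun j _ =>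
      (h.linearModel hx).condOrth j
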